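/- Let $n\ge 3$, let $\mathbb S^{n-2}$ be the unit sphere of $\mathbb R^{n-1}$, and let $\nabla_{\mathbb S^{n-2}}$ and $\Delta_{\mathbb S^{n-2}}$ denote its gradient and its Laplace–Beltrami operator. An origin-centred ellipsoid in $\mathbb R^{n-1}$ is a set $T\bigl(\{x\in\mathbb R^{n-1} : \sum_{i=1}^{n-1} x_i^2/\lambda_i^2=1\}\bigr)$ with $\lambda_1,\dots,\lambda_{n-1}>0$ and $T\in \mathrm O(n-1)$, and the support function of a set $E$ is $h_E(u)=\sup\{x\cdot u : x\in E\}$. Let $h\in C^2(\mathbb S^{n-2})$ be a real function that vanishes nowhere on $\mathbb S^{n-2}$. Then the function $\Delta_{\mathbb S^{n-2}} h^2+2(n-1)h^2$ is differentiable on $\mathbb S^{n-2}$ with $$\nabla_{\mathbb S^{n-2}}\bigl[\Delta_{\mathbb S^{n-2}} h^2+2(n-1)h^2\bigr](u)=0\qquad\text{for every }u\in\mathbb S^{n-2}$$ if and only if $h$ or $-h$ is the restriction to $\mathbb S^{n-2}$ of the support function of an origin-centred ellipsoid in $\mathbb R^{n-1}$. -/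

import Mathlib

open scoped Manifold

/-- The extension of a function on the unit sphere to the whole space that is constant along
rays from the origin, `x ↦ f (x / ‖x‖)` for `x ≠ 0` (the value at `0` plays no role). -/
noncomputable def radialExtension {E : Type*} [NormedAddCommGroup E] [InnerProductSpace ℝ E]
    (f : Metric.sphere (0 : E) 1 → ℝ) (x : E) : ℝ :=
  open Classical in
  if hx : x ≠ 0 then
    f ⟨‖x‖⁻¹ • x, by
      rw [mem_sphere_zero_iff_norm, norm_smul, norm_inv, norm_norm]
      exact inv_mul_cancel₀ (norm_ne_zero_iff.mpr hx)⟩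
  else 0

/-- The Laplace–Beltrami operator of the unit sphere, on `C²` functions: the restriction to the
sphere of the ambient Laplacian of the extension that is constant along rays. (In polar
coordinates `Δ = ∂²/∂r² + ((m - 1)/r) ∂/∂r + r⁻² Δ_S` on `ℝᵐ`, and the radial terms vanish.) -/
noncomputable def sphericalLaplacian {E : Type*} [NormedAddCommGroup E] [InnerProductSpace ℝ E]
    [FiniteDimensional ℝ E] (f : Metric.sphere (0 : E) 1 → ℝ) (u : Metric.sphere (0 : E) 1) : ℝ :=
  Laplacian.laplacian (radialExtension f) (u : E)

/-- `f` is differentiable at the point `u` of the unit sphere, with spherical gradient `g`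
(a tangent vector at `u`, regarded as a vector of the ambient space): the ambient gradient at `u`
of the extension that is constant along rays. -/
def HasSphericalGradientAt {E : Type*} [NormedAddCommGroup E] [InnerProductSpace ℝ E]
    [CompleteSpace E] (f : Metric.sphere (0 : E) 1 → ℝ) (g : E) (u : Metric.sphere (0 : E) 1) :
    Prop :=
  HasGradientAt (radialExtension f) g (u : E)

/-- An ellipsoid in `ℝᵐ` centred at the origin: the image of a coordinate ellipsoid
`∑ xᵢ² / lᵢ² = 1` with semi-axes `lᵢ > 0` under an orthogonal transformation. -/
def IsOriginCenteredEllipsoid {m : ℕ} (S : Set (EuclideanSpace ℝ (Fin m))) : Prop :=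
  ∃ (l : Fin m → ℝ) (T : EuclideanSpace ℝ (Fin m) ≃ₗᵢ[ℝ] EuclideanSpace ℝ (Fin m)),
    (∀ i, 0 < l i) ∧ S = T '' {x | ∑ i, x i ^ 2 / l i ^ 2 = 1}

/-- The support function of a nonempty bounded set `S`, `u ↦ sup {x · u : x ∈ S}`. It is also the
support function of the convex body spanned by `S`. -/
noncomputable def supportFunction {E : Type*} [NormedAddCommGroup E] [InnerProductSpace ℝ E]
    (S : Set E) (u : E) : ℝ :=
  sSup ((fun x : E => inner ℝ x u) '' S)

/-!
The extension `F` of `f = h ^ 2` to `ℝᵐ`, `m = n - 1`, that is homogeneous of degree two satisfies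
`Δ F = Δ_S f + 2 m f` on the sphere, and `Δ F` is homogeneous of degree zero. So the spherical
gradient vanishes iff `Δ F` is a constant `c` away from the origin, i.e. iff
`G x = F x - c / (2 m) * ‖x‖ ^ 2` is harmonic there. By homogeneity the derivative of `G` is
Lipschitz across the origin, so that Green's formula, and with it the mean value property against a
smooth radial kernel, holds on the whole space; hence `G` is smooth, and a homogeneous function of
degree two that is `C²` at the origin is a quadratic form. Thus the condition says that `h ^ 2` is
the restriction of a quadratic form, positive because `h` has no zeros. By the principal axis
theorem the square roots of positive definite forms are exactly the support functions of
ellipsoids, and the sign of `h` is constant because the sphere is connected.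
-/

open MeasureTheory Module Set Filter Asymptotics
open scoped ContDiff Gradient InnerProductSpace Laplacian Topology

section Laplacian

variable {E : Type*} [NormedAddCommGroup E] [InnerProductSpace ℝ E] [FiniteDimensional ℝ E]
  {ι : Type*} [Fintype ι]

theorem laplacian_eq_sum_fderiv_fderiv (b : OrthonormalBasis ι ℝ E) (f : E → ℝ) (x : E) :
    Δ f x = ∑ i, fderiv ℝ (fderiv ℝ f) x (b i) (b i) := by
  rw [InnerProductSpace.laplacian_eq_iteratedFDeriv_orthonormalBasis f b]
  simp [iteratedFDeriv_two_apply]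

theorem sum_fderiv_mul_fderiv (b : OrthonormalBasis ι ℝ E) (f g : E → ℝ) (x : E) :
    ∑ i, fderiv ℝ f x (b i) * fderiv ℝ g x (b i) = ⟪∇ f x, ∇ g x⟫_ℝ := by
  rw [← b.sum_inner_mul_inner]
  simp

theorem laplacian_mul {f g : E → ℝ} {x : E} (hf : ContDiffAt ℝ 2 f x) (hg : ContDiffAt ℝ 2 g x) :
    Δ (fun y => f y * g y) x = f x * Δ g x + 2 * ⟪∇ f x, ∇ g x⟫_ℝ + g x * Δ f x := by
  have hfderiv : fderiv ℝ (fun y => f y * g y) =ᶠ[𝓝 x]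
      fun y => f y • fderiv ℝ g y + g y • fderiv ℝ f y := by
    filter_upwards [hf.eventually (by simp), hg.eventually (by simp)] with y hfy hgy
    exact fderiv_fun_mul (hfy.differentiableAt two_ne_zero) (hgy.differentiableAt two_ne_zero)
  have hf' := (hf.differentiableAt two_ne_zero).hasFDerivAt
  have hg' := (hg.differentiableAt two_ne_zero).hasFDerivAt
  have hf'' := ((hf.fderiv_right (m := 1) le_rfl).differentiableAt one_ne_zero).hasFDerivAt
  have hg'' := ((hg.fderiv_right (m := 1) le_rfl).differentiableAt one_ne_zero).hasFDerivAt
  have hfderiv2 : fderiv ℝ (fderiv ℝ fun y => f y * g y) x = _ :=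
    hfderiv.fderiv_eq.trans ((hf'.fun_smul hg'').fun_add (hg'.fun_smul hf'')).fderiv
  let b := stdOrthonormalBasis ℝ E
  simp only [laplacian_eq_sum_fderiv_fderiv b, ← sum_fderiv_mul_fderiv b, hfderiv2,
    Finset.mul_sum, ← Finset.sum_add_distrib]
  refine Finset.sum_congr rfl fun i _ => ?_
  simp only [add_apply, smul_apply, ContinuousLinearMap.smulRight_apply, smul_eq_mul]
  ring

theorem contDiff_quadraticForm (Q : QuadraticForm ℝ E) {n : ℕ∞ω} : ContDiff ℝ n Q := by
  let B := (QuadraticMap.associated Q).toContinuousBilinearMap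
  rw [show ⇑Q = fun x => B x x from
    funext fun x => (QuadraticMap.associated_eq_self_apply ℝ Q x).symm]
  exact B.contDiff.clm_apply contDiff_id

theorem laplacian_quadraticForm (b : OrthonormalBasis ι ℝ E) (Q : QuadraticForm ℝ E) (x : E) :
    Δ (⇑Q) x = 2 * ∑ i, Q (b i) := by
  let B := (QuadraticMap.associated Q).toContinuousBilinearMap
  have hB (y : E) : Q y = B y y := (QuadraticMap.associated_eq_self_apply ℝ Q y).symm
  have hfderiv : fderiv ℝ Q = (B + B.flip : E →L[ℝ] E →L[ℝ] ℝ) := by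
    funext y
    rw [funext hB]
    refine (B.hasFDerivAt.clm_apply (hasFDerivAt_id y)).fderiv.trans ?_
    ext z
    simp
  have hfderiv2 : fderiv ℝ (fderiv ℝ Q) x = B + B.flip := by
    rw [hfderiv, ContinuousLinearMap.fderiv]
  simp [laplacian_eq_sum_fderiv_fderiv b, hfderiv2, hB, two_mul, Finset.sum_add_distrib]

theorem laplacian_norm_sq (x : E) : Δ (fun y : E => ‖y‖ ^ 2) x = 2 * finrank ℝ E := by
  have hnorm : (fun y : E => ‖y‖ ^ 2) = LinearMap.BilinMap.toQuadraticMap (innerₗ E) := by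
    funext y
    simp
  rw [hnorm, laplacian_quadraticForm (stdOrthonormalBasis ℝ E)]
  simp

end Laplacian

/-- `f` is positively homogeneous of degree `k`. Only positive scalars are involved, so that for
`k = 0` these are the functions that are constant along open rays from the origin. -/
def IsPosHomogeneous {E V : Type*} [NormedAddCommGroup E] [NormedSpace ℝ E]
    [NormedAddCommGroup V] [NormedSpace ℝ V] (k : ℕ) (f : E → V) : Prop :=
  ∀ ⦃t : ℝ⦄, 0 < t → ∀ x, f (t • x) = t ^ k • f x

namespace IsPosHomogeneous

variable {E V : Type*} [NormedAddCommGroup E] [NormedSpace ℝ E]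
  [NormedAddCommGroup V] [NormedSpace ℝ V] {f : E → V} {k : ℕ}

theorem apply_zero (hf : IsPosHomogeneous k f) (hk : k ≠ 0) : f 0 = 0 := by
  have h : ((2 : ℝ) ^ k - 1) • f 0 = 0 := by
    rw [sub_smul, ← hf two_pos, smul_zero, one_smul, sub_self]
  exact (smul_eq_zero.1 h).resolve_left (sub_ne_zero.2 (one_lt_pow₀ one_lt_two hk).ne')

theorem eq_norm_pow_smul (hf : IsPosHomogeneous k f) {x : E} (hx : x ≠ 0) :
    f x = ‖x‖ ^ k • f (‖x‖⁻¹ • x) := by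
  rw [← hf (norm_pos_iff.2 hx), smul_inv_smul₀ (norm_ne_zero_iff.2 hx)]

theorem sub {g : E → V} (hf : IsPosHomogeneous k f) (hg : IsPosHomogeneous k g) :
    IsPosHomogeneous k (f - g) := fun t ht x => by
  simp [hf ht, hg ht, smul_sub]

theorem fderiv (hf : IsPosHomogeneous (k + 1) f) : IsPosHomogeneous k (fderiv ℝ f) := by
  intro t ht x
  have h : t • _root_.fderiv ℝ f (t • x) = t ^ (k + 1) • _root_.fderiv ℝ f x := by
    rw [← fderiv_comp_smul, funext (hf ht)]
    exact congrFun (fderiv_const_smul_field (𝕜 := ℝ) (t ^ (k + 1)) (f := f)) x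
  rw [pow_succ', mul_smul] at h
  exact smul_right_injective _ ht.ne' h

theorem laplacian {E : Type*} [NormedAddCommGroup E] [InnerProductSpace ℝ E]
    [FiniteDimensional ℝ E] {f : E → ℝ} (hf : IsPosHomogeneous (k + 2) f) :
    IsPosHomogeneous k (Δ f) := by
  intro t ht x
  let b := stdOrthonormalBasis ℝ E
  simp [laplacian_eq_sum_fderiv_fderiv b, hf.fderiv.fderiv ht x, Finset.mul_sum]

theorem fderiv_apply_self (hf : IsPosHomogeneous k f) {x : E} (hd : DifferentiableAt ℝ f x) :
    _root_.fderiv ℝ f x x = (k : ℝ) • f x := by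
  have hray : HasDerivAt (fun t : ℝ => t • x) x 1 := by
    simpa using (hasDerivAt_id (1 : ℝ)).smul_const x
  have hd' : HasFDerivAt f (_root_.fderiv ℝ f x) ((1 : ℝ) • x) := by
    simpa using hd.hasFDerivAt
  have hpow : HasDerivAt (fun t : ℝ => t ^ k • f x) ((k : ℝ) • f x) 1 := by
    simpa using (hasDerivAt_pow k (1 : ℝ)).smul_const (f x)
  refine (hd'.comp_hasDerivAt 1 hray).unique (hpow.congr_of_eventuallyEq ?_)
  filter_upwards [lt_mem_nhds one_pos] with t ht using hf ht x

theorem eq_fderiv_zero (hf : IsPosHomogeneous 1 f) (hd : DifferentiableAt ℝ f 0) (x : E) :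
    f x = _root_.fderiv ℝ f 0 x := by
  have hf0 := hf.apply_zero one_ne_zero
  have hconst : (fun c : ℝ => c • (f (c⁻¹ • x) - f 0)) =ᶠ[atTop] fun _ => f x := by
    filter_upwards [eventually_gt_atTop 0] with c hc
    rw [hf (inv_pos.2 hc), hf0, pow_one, sub_zero, smul_inv_smul₀ hc.ne']
  have hlim := hd.hasFDerivAt.lim_real x
  simp only [zero_add] at hlim
  exact tendsto_nhds_unique (tendsto_const_nhds.congr' hconst.symm) hlim

theorem exists_quadraticForm {f : E → ℝ} (hf : IsPosHomogeneous 2 f) (hd : ContDiff ℝ 2 f) :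
    ∃ Q : QuadraticForm ℝ E, ∀ x, f x = Q x := by
  have hd' : ContDiff ℝ 1 (_root_.fderiv ℝ f) := hd.fderiv_right le_rfl
  let B : LinearMap.BilinForm ℝ E := (_root_.fderiv ℝ (_root_.fderiv ℝ f) 0).toBilinForm
  refine ⟨(2⁻¹ : ℝ) • B.toQuadraticMap, fun x => ?_⟩
  have hB : B x x = 2 * f x := calc
    B x x = _root_.fderiv ℝ f x x := by
      rw [hf.fderiv.eq_fderiv_zero (hd'.differentiable one_ne_zero 0) x]
      rfl
    _ = 2 * f x := by
      simpa using hf.fderiv_apply_self (hd.differentiable two_ne_zero x)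
  simp [hB]

theorem exists_norm_le [FiniteDimensional ℝ E] (hf : IsPosHomogeneous k f)
    (hc : ContinuousOn f {0}ᶜ) : ∃ C : ℝ, 0 ≤ C ∧ ∀ x ≠ 0, ‖f x‖ ≤ C * ‖x‖ ^ k := by
  have hsphere : Metric.sphere (0 : E) 1 ⊆ {0}ᶜ := by
    rintro x hx rfl
    simp at hx
  obtain ⟨C, hC⟩ := (isCompact_sphere (0 : E) 1).exists_bound_of_continuousOn (hc.mono hsphere)
  refine ⟨|C|, abs_nonneg C, fun x hx => ?_⟩
  rw [hf.eq_norm_pow_smul hx, norm_smul, norm_pow, norm_norm, mul_comm]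
  gcongr
  exact (hC _ (by simp [norm_smul, hx])).trans (le_abs_self C)

theorem hasFDerivAt_zero [FiniteDimensional ℝ E] (hf : IsPosHomogeneous k f) (hk : 1 < k)
    (hc : ContinuousOn f {0}ᶜ) : HasFDerivAt f (0 : E →L[ℝ] V) 0 := by
  have hf0 := hf.apply_zero (by lia)
  obtain ⟨C, -, hC⟩ := hf.exists_norm_le hc
  have hO : f =O[𝓝 0] fun x => ‖x‖ ^ k := by
    refine IsBigO.of_bound C (.of_forall fun x => ?_)
    rcases eq_or_ne x 0 with rfl | hx
    · simp [hf0, (zero_lt_one.trans hk).ne']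
    · simpa using hC x hx
  rw [hasFDerivAt_iff_isLittleO_nhds_zero]
  simpa [hf0] using hO.trans_isLittleO (isLittleO_norm_pow_id hk)

theorem exists_lipschitzWith [FiniteDimensional ℝ E] (hf : IsPosHomogeneous 1 f)
    (hd : ∀ x ≠ 0, ContDiffAt ℝ 1 f x) : ∃ L, LipschitzWith L f := by
  obtain ⟨C, hC, hfC⟩ := hf.exists_norm_le
    fun x hx => (hd x hx).continuousAt.continuousWithinAt
  obtain ⟨D, -, hfD⟩ := hf.fderiv.exists_norm_le
    fun x hx => ((hd x hx).fderiv_right (m := 0) le_rfl).continuousAt.continuousWithinAt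
  have hfC' (x : E) : ‖f x‖ ≤ C * ‖x‖ := by
    rcases eq_or_ne x 0 with rfl | hx
    · simp [hf.apply_zero one_ne_zero]
    · simpa using hfC x hx
  refine ⟨(max C D).toNNReal, LipschitzWith.of_dist_le_mul fun x y => ?_⟩
  rw [dist_eq_norm, dist_eq_norm, Real.coe_toNNReal _ (le_max_of_le_left hC)]
  -- The mean value inequality fails only on segments through `0`, where the norms add up.
  by_cases h0 : (0 : E) ∈ segment ℝ x y
  · have hxy : ‖x‖ + ‖y‖ = ‖x - y‖ := by
      simpa [dist_eq_norm] using dist_add_dist_of_mem_segment h0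
    calc ‖f x - f y‖ ≤ ‖f x‖ + ‖f y‖ := norm_sub_le _ _
      _ ≤ C * ‖x‖ + C * ‖y‖ := add_le_add (hfC' x) (hfC' y)
      _ = C * ‖x - y‖ := by rw [← hxy, mul_add]
      _ ≤ max C D * ‖x - y‖ := by gcongr; exact le_max_left C D
  · have hne : ∀ z ∈ segment ℝ x y, z ≠ 0 := fun z hz hz0 => h0 (hz0 ▸ hz)
    calc ‖f x - f y‖ ≤ D * ‖x - y‖ :=
          (convex_segment x y).norm_image_sub_le_of_norm_fderiv_le
            (fun z hz => (hd z (hne z hz)).differentiableAt one_ne_zero)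
            (fun z hz => by simpa using hfD z (hne z hz))
            (right_mem_segment ℝ x y) (left_mem_segment ℝ x y)
      _ ≤ max C D * ‖x - y‖ := by gcongr; exact le_max_right C D

end IsPosHomogeneous

section RadialKernel

/-- A smooth nonincreasing cutoff of the half-line, equal to `1` on `t ≤ 1` and to `0` on
`2 ≤ t`; evaluated at `‖y‖ ^ 2` it gives radial test functions. -/
noncomputable def smoothCutoff (t : ℝ) : ℝ :=
  Real.smoothTransition (2 - t)

theorem contDiff_smoothCutoff : ContDiff ℝ ∞ smoothCutoff :=
  Real.smoothTransition.contDiff.comp (contDiff_const.sub contDiff_id)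

theorem antitone_smoothCutoff : Antitone smoothCutoff := fun _ _ hst =>
  Real.smoothTransition.monotone (sub_le_sub_left hst 2)

theorem smoothCutoff_one : smoothCutoff 1 = 1 :=
  Real.smoothTransition.one_of_one_le (by norm_num)

theorem smoothCutoff_eq_zero {t : ℝ} (ht : 2 ≤ t) : smoothCutoff t = 0 :=
  Real.smoothTransition.zero_of_nonpos (sub_nonpos.2 ht)

theorem deriv_smoothCutoff_eq_zero {t : ℝ} (ht : 2 < t) : deriv smoothCutoff t = 0 := by
  have h : smoothCutoff =ᶠ[𝓝 t] fun _ => 0 := by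
    filter_upwards [lt_mem_nhds ht] with s hs using smoothCutoff_eq_zero hs.le
  rw [h.deriv_eq, deriv_const]

variable {E : Type*} [NormedAddCommGroup E]

/-- A smooth radial function whose gradient is `y ↦ -2 * radialKernel y • y`. -/
noncomputable def radialPotential (y : E) : ℝ :=
  smoothCutoff (‖y‖ ^ 2)

/-- A smooth nonnegative radial averaging kernel, not normalised. It is built from a derivative so
that `y ↦ radialKernel y • y` is a gradient: this is what lets the divergence theorem act on the
radial derivative of the averages against it. -/
noncomputable def radialKernel (y : E) : ℝ :=
  -deriv smoothCutoff (‖y‖ ^ 2)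

theorem radialKernel_neg (y : E) : radialKernel (-y) = radialKernel y := by
  rw [radialKernel, radialKernel, norm_neg]

variable [InnerProductSpace ℝ E]

theorem contDiff_radialPotential : ContDiff ℝ ∞ (radialPotential : E → ℝ) :=
  contDiff_smoothCutoff.comp (contDiff_norm_sq ℝ)

theorem contDiff_radialKernel : ContDiff ℝ ∞ (radialKernel : E → ℝ) :=
  ((contDiff_infty_iff_deriv.1 contDiff_smoothCutoff).2.comp (contDiff_norm_sq ℝ)).neg

theorem fderiv_radialPotential_apply (y v : E) :
    fderiv ℝ radialPotential y v = -2 * radialKernel y * ⟪y, v⟫_ℝ := by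
  have hcutoff : HasDerivAt smoothCutoff (deriv smoothCutoff (‖y‖ ^ 2)) (‖y‖ ^ 2) :=
    (contDiff_smoothCutoff.differentiable (by simp) _).hasDerivAt
  have h : fderiv ℝ radialPotential y = _ :=
    (hcutoff.comp_hasFDerivAt y (hasStrictFDerivAt_norm_sq y).hasFDerivAt).fderiv
  simp only [h, radialKernel, smul_apply, innerSL_apply_apply, smul_eq_mul, nsmul_eq_mul,
    Nat.cast_ofNat]
  ring

theorem gradient_radialPotential_comp_smul_sub [CompleteSpace E] (c : ℝ) (x z : E) :
    ∇ (radialPotential ∘ fun w => c • (x - w)) z =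
      (2 * c * radialKernel (c • (x - z))) • c • (x - z) := by
  have hpot := contDiff_radialPotential.differentiable (by simp) (c • (x - z))
  have hdil : HasFDerivAt (fun w => c • (x - w)) (-(c • ContinuousLinearMap.id ℝ E)) z := by
    simpa using ((hasFDerivAt_id (𝕜 := ℝ) z).const_sub x).fun_const_smul c
  refine ext_inner_right ℝ fun v => ?_
  rw [inner_gradient_left, (hpot.hasFDerivAt.comp z hdil).fderiv, ContinuousLinearMap.comp_apply,
    fderiv_radialPotential_apply]
  simp only [neg_mul, neg_apply, smul_apply, ContinuousLinearMap.id_apply, inner_neg_right,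
    real_inner_smul_left, real_inner_smul_right]
  ring

variable [FiniteDimensional ℝ E]

theorem hasCompactSupport_comp_norm_sq {g : ℝ → ℝ} (hg : ∀ t, 2 < t → g t = 0) :
    HasCompactSupport fun y : E => g (‖y‖ ^ 2) := by
  refine HasCompactSupport.intro (isCompact_closedBall (0 : E) 2) fun y hy => hg _ ?_
  rw [mem_closedBall_zero_iff, not_le] at hy
  nlinarith

theorem hasCompactSupport_radialPotential : HasCompactSupport (radialPotential : E → ℝ) :=
  hasCompactSupport_comp_norm_sq fun _ ht => smoothCutoff_eq_zero ht.le

theorem hasCompactSupport_radialKernel : HasCompactSupport (radialKernel : E → ℝ) :=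
  hasCompactSupport_comp_norm_sq (g := fun t => -deriv smoothCutoff t) fun t ht => by
    rw [deriv_smoothCutoff_eq_zero ht, neg_zero]

theorem integral_radialKernel_pos [Nontrivial E] [MeasurableSpace E] [BorelSpace E]
    (μ : Measure E) [μ.IsAddHaarMeasure] : 0 < ∫ y, radialKernel y ∂μ := by
  obtain ⟨t, ht, hslope⟩ := exists_deriv_eq_slope smoothCutoff one_lt_two
    contDiff_smoothCutoff.continuous.continuousOn
    (contDiff_smoothCutoff.differentiable (by simp)).differentiableOn
  obtain ⟨y, hy⟩ := exists_norm_eq E (Real.sqrt_nonneg t)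
  have hker : radialKernel y = 1 := by
    rw [radialKernel, hy, Real.sq_sqrt (zero_le_one.trans ht.1.le), hslope, smoothCutoff_one,
      smoothCutoff_eq_zero le_rfl]
    norm_num
  exact contDiff_radialKernel.continuous.integral_pos_of_hasCompactSupport_nonneg_nonzero
    hasCompactSupport_radialKernel
    (fun z => neg_nonneg.2 antitone_smoothCutoff.deriv_nonpos) (hker.trans_ne one_ne_zero)

end RadialKernel

section IntegrationByParts

variable {E : Type*} [NormedAddCommGroup E] [NormedSpace ℝ E] [MeasurableSpace E] [BorelSpace E]
  {μ : Measure E} {f χ : E → ℝ} {L : NNReal}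

theorem integrable_fderiv_mul [IsFiniteMeasureOnCompacts μ] (hf : LipschitzWith L f)
    (hχ : Continuous χ) (hχc : HasCompactSupport χ) (v : E) :
    Integrable (fun x => fderiv ℝ f x v * χ x) μ :=
  (hχ.integrable_of_hasCompactSupport hχc).bdd_mul (c := L * ‖v‖)
    (measurable_fderiv_apply_const ℝ f v).aestronglyMeasurable
    (.of_forall fun x => (fderiv ℝ f x).le_of_opNorm_le (norm_fderiv_le_of_lipschitz ℝ hf) v)

theorem hasDerivAt_integral_comp_sub_smul_mul [IsFiniteMeasureOnCompacts μ]
    (hf : ContDiff ℝ 1 f) (hχ : Continuous χ) (hχc : HasCompactSupport χ) (x : E)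
    (r : ℝ) :
    HasDerivAt (fun s : ℝ => ∫ y, f (x - s • y) * χ y ∂μ)
      (-∫ y, fderiv ℝ f (x - r • y) y * χ y ∂μ) r := by
  have hfc := hf.continuous
  have hcont : Continuous fun p : ℝ × E => -(fderiv ℝ f (x - p.1 • p.2) p.2 * χ p.2) := by
    have := hf.continuous_fderiv one_ne_zero
    fun_prop
  obtain ⟨C, hC⟩ := ((isCompact_Icc (a := r - 1) (b := r + 1)).prod
    hχc.isCompact).exists_bound_of_continuousOn hcont.continuousOn
  rw [← integral_neg]
  refine (hasDerivAt_integral_of_dominated_loc_of_deriv_le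
    (F := fun s y => f (x - s • y) * χ y)
    (F' := fun s y => -(fderiv ℝ f (x - s • y) y * χ y))
    (bound := (tsupport χ).indicator fun _ => C)
    (Icc_mem_nhds (sub_one_lt r) (lt_add_one r)) ?_ ?_ ?_ ?_ ?_ ?_).2
  · exact .of_forall fun s => Continuous.aestronglyMeasurable (by fun_prop)
  · exact Continuous.integrable_of_hasCompactSupport (by fun_prop) hχc.mul_left
  · exact (hcont.comp (Continuous.prodMk_right r)).aestronglyMeasurable
  · refine .of_forall fun y s hs => ?_
    by_cases hy : y ∈ tsupport χ
    · rw [indicator_of_mem hy]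
      exact hC (s, y) ⟨hs, hy⟩
    · simp [indicator_of_notMem hy, image_eq_zero_of_notMem_tsupport hy]
  · exact (integrableOn_const hχc.isCompact.measure_lt_top.ne).integrable_indicator
      hχc.isCompact.isClosed.measurableSet
  · refine .of_forall fun y s _ => ?_
    have hray : HasDerivAt (fun s : ℝ => x - s • y) (-y) s := by
      simpa using ((hasDerivAt_id s).smul_const y).const_sub x
    simpa using ((hf.differentiable one_ne_zero _).hasFDerivAt.comp_hasDerivAt s hray).mul_const
      (χ y)

variable [FiniteDimensional ℝ E] [μ.IsAddHaarMeasure]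

theorem integral_mul_fderiv_eq_neg (hf : LipschitzWith L f) (hχ : ContDiff ℝ 1 χ)
    (hχc : HasCompactSupport χ) (v : E) :
    ∫ x, f x * fderiv ℝ χ x v ∂μ = -∫ x, fderiv ℝ f x v * χ x ∂μ := by
  obtain ⟨D, hD⟩ := hχ.lipschitzWith_of_hasCompactSupport hχc one_ne_zero
  have hline : ∫ x, lineDeriv ℝ f x v * χ x ∂μ = ∫ x, fderiv ℝ f x v * χ x ∂μ := by
    refine integral_congr_ae ?_
    filter_upwards [hf.ae_differentiableAt] with x hx
    rw [hx.lineDeriv_eq_fderiv]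
  rw [← hline, hf.integral_lineDeriv_mul_eq hD hχc, ← integral_neg]
  refine integral_congr_ae (.of_forall fun x => ?_)
  simp [(hχ.differentiable one_ne_zero x).lineDeriv_eq_fderiv, mul_comm]

end IntegrationByParts

section Harmonic

variable {E : Type*} [NormedAddCommGroup E] [InnerProductSpace ℝ E] [FiniteDimensional ℝ E]
  [MeasurableSpace E] [BorelSpace E] {μ : Measure E} [μ.IsAddHaarMeasure] {G χ : E → ℝ}
  {L : NNReal}

theorem integral_inner_gradient_gradient_eq_neg (hG : LipschitzWith L (fderiv ℝ G))
    (hχ : ContDiff ℝ 1 χ) (hχc : HasCompactSupport χ) :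
    ∫ x, ⟪∇ G x, ∇ χ x⟫_ℝ ∂μ = -∫ x, Δ G x * χ x ∂μ := by
  let b := stdOrthonormalBasis ℝ E
  have hlip (i) : LipschitzWith L fun x => fderiv ℝ G x (b i) := by
    refine LipschitzWith.of_dist_le_mul fun x y => ?_
    rw [dist_eq_norm, ← sub_apply]
    refine ((fderiv ℝ G x - fderiv ℝ G y).le_opNorm (b i)).trans ?_
    rw [b.norm_eq_one, mul_one, ← dist_eq_norm]
    exact hG.dist_le_mul x y
  have hΔ : Δ G =ᵐ[μ] fun x => ∑ i, fderiv ℝ (fun y => fderiv ℝ G y (b i)) x (b i) := by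
    filter_upwards [hG.ae_differentiableAt] with x hx
    rw [laplacian_eq_sum_fderiv_fderiv b]
    refine Finset.sum_congr rfl fun i _ => ?_
    simp [(hx.hasFDerivAt.clm_apply (hasFDerivAt_const (b i) x)).fderiv]
  calc ∫ x, ⟪∇ G x, ∇ χ x⟫_ℝ ∂μ
      = ∑ i, ∫ x, fderiv ℝ G x (b i) * fderiv ℝ χ x (b i) ∂μ := by
        simp only [← sum_fderiv_mul_fderiv b]
        refine integral_finsetSum _ fun i _ => ?_
        exact ((hlip i).continuous.mul ((hχ.continuous_fderiv one_ne_zero).clm_apply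
          continuous_const)).integrable_of_hasCompactSupport (hχc.fderiv_apply ℝ (b i)).mul_left
    _ = -∑ i, ∫ x, fderiv ℝ (fun y => fderiv ℝ G y (b i)) x (b i) * χ x ∂μ := by
        simp only [integral_mul_fderiv_eq_neg (hlip _) hχ hχc, Finset.sum_neg_distrib]
    _ = -∫ x, Δ G x * χ x ∂μ := by
        rw [← integral_finsetSum _ fun i _ => integrable_fderiv_mul (hlip i) hχ.continuous hχc _]
        congr 1
        refine integral_congr_ae ?_
        filter_upwards [hΔ] with x hx
        rw [hx, Finset.sum_mul]

theorem integral_fderiv_comp_sub_smul_mul_radialKernel (hG : LipschitzWith L (fderiv ℝ G))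
    (hΔ : Δ G =ᵐ[μ] 0) (x : E) (r : ℝ) :
    ∫ y, fderiv ℝ G (x - r • y) y * radialKernel y ∂μ = 0 := by
  rcases eq_or_ne r 0 with rfl | hr
  · have hodd := integral_neg_eq_self (fun y => fderiv ℝ G x y * radialKernel y) μ
    simp only [map_neg, radialKernel_neg, neg_mul, integral_neg] at hodd
    simpa using self_eq_neg.1 hodd.symm
  let e : E ≃ₜ E := (Homeomorph.subLeft x).trans (Homeomorph.smulOfNeZero r⁻¹ (inv_ne_zero hr))
  let χ : E → ℝ := radialPotential ∘ fun w => r⁻¹ • (x - w)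
  let Φ (y : E) : ℝ := fderiv ℝ G (x - r • y) y * radialKernel y
  have hcenter (z : E) : x - r • r⁻¹ • (x - z) = z := by
    rw [smul_inv_smul₀ hr, sub_sub_cancel]
  have hχ : ContDiff ℝ 1 χ := (contDiff_infty.1 contDiff_radialPotential 1).comp
    (contDiff_const.smul (contDiff_const.sub contDiff_id))
  have hχc : HasCompactSupport χ := hasCompactSupport_radialPotential.comp_homeomorph e
  have hinner (z : E) : ⟪∇ G z, ∇ χ z⟫_ℝ = 2 * r⁻¹ * Φ (r⁻¹ • (x - z)) := by
    simp only [χ, Φ, hcenter, inner_gradient_left, gradient_radialPotential_comp_smul_sub, map_smul,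
      smul_eq_mul]
    ring
  have hgreen : ∫ z, ⟪∇ G z, ∇ χ z⟫_ℝ ∂μ = 0 := by
    rw [integral_inner_gradient_gradient_eq_neg hG hχ hχc, neg_eq_zero]
    refine integral_eq_zero_of_ae ?_
    filter_upwards [hΔ] with z hz
    simp [hz]
  have hsubst : ∫ z, Φ (r⁻¹ • (x - z)) ∂μ = |r ^ finrank ℝ E| * ∫ y, Φ y ∂μ := by
    rw [integral_sub_left_eq_self (fun z => Φ (r⁻¹ • z)) μ x, Measure.integral_comp_inv_smul,
      smul_eq_mul]
  simp only [hinner, integral_const_mul, hsubst] at hgreen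
  simpa [hr] using hgreen

theorem integral_comp_sub_mul_radialKernel (hGd : ContDiff ℝ 1 G)
    (hG : LipschitzWith L (fderiv ℝ G)) (hΔ : Δ G =ᵐ[μ] 0) (x : E) :
    ∫ y, G (x - y) * radialKernel y ∂μ = G x * ∫ y, radialKernel y ∂μ := by
  -- The average at scale `s` does not depend on `s`; compare the scales `1` and `0`.
  have hderiv (r : ℝ) : HasDerivAt (fun s : ℝ => ∫ y, G (x - s • y) * radialKernel y ∂μ) 0 r := by
    simpa only [integral_fderiv_comp_sub_smul_mul_radialKernel hG hΔ, neg_zero] using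
      hasDerivAt_integral_comp_sub_smul_mul (μ := μ) hGd contDiff_radialKernel.continuous
        hasCompactSupport_radialKernel x r
  simpa [integral_const_mul] using is_const_of_deriv_eq_zero
    (fun r => (hderiv r).differentiableAt) (fun r => (hderiv r).deriv) 1 0

theorem contDiff_of_laplacian_ae_eq_zero (hGd : ContDiff ℝ 1 G)
    (hG : LipschitzWith L (fderiv ℝ G)) (hΔ : Δ G =ᵐ[μ] 0) : ContDiff ℝ ∞ G := by
  cases subsingleton_or_nontrivial E
  · rw [show G = fun _ => G 0 from funext fun x => congrArg G (Subsingleton.elim x 0)]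
    exact contDiff_const
  have hmean : G = fun x => (∫ y, radialKernel y ∂μ)⁻¹ *
      convolution radialKernel G (ContinuousLinearMap.mul ℝ ℝ) μ x := by
    funext x
    rw [eq_inv_mul_iff_mul_eq₀ (integral_radialKernel_pos μ).ne', mul_comm,
      ← integral_comp_sub_mul_radialKernel hGd hG hΔ]
    simp [convolution, mul_comm]
  rw [hmean]
  exact contDiff_const.mul (hasCompactSupport_radialKernel.contDiff_convolution_left _
    contDiff_radialKernel hGd.continuous.locallyIntegrable)

end Harmonic

namespace IsPosHomogeneous

variable {E : Type*} [NormedAddCommGroup E] [InnerProductSpace ℝ E] [FiniteDimensional ℝ E]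
  {f : E → ℝ}

theorem contDiff_one (hf : IsPosHomogeneous 2 f) (hd : ∀ x ≠ 0, ContDiffAt ℝ 2 f x) :
    ContDiff ℝ 1 f := by
  obtain ⟨L, hL⟩ := hf.fderiv.exists_lipschitzWith fun x hx => (hd x hx).fderiv_right le_rfl
  refine contDiff_one_iff_fderiv.2 ⟨fun x => ?_, hL.continuous⟩
  rcases eq_or_ne x 0 with rfl | hx
  · exact (hf.hasFDerivAt_zero one_lt_two
      fun x hx => (hd x hx).continuousAt.continuousWithinAt).differentiableAt
  · exact (hd x hx).differentiableAt two_ne_zero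

theorem exists_quadraticForm_of_laplacian_eq_zero [Nontrivial E] (hf : IsPosHomogeneous 2 f)
    (hd : ∀ x ≠ 0, ContDiffAt ℝ 2 f x) (hΔ : ∀ x ≠ 0, Δ f x = 0) :
    ∃ Q : QuadraticForm ℝ E, ∀ x, f x = Q x := by
  borelize E
  obtain ⟨L, hL⟩ := hf.fderiv.exists_lipschitzWith fun x hx => (hd x hx).fderiv_right le_rfl
  have hΔae : Δ f =ᵐ[volume] 0 := by
    filter_upwards [Measure.ae_ne volume (0 : E)] with x hx using hΔ x hx
  exact hf.exists_quadraticForm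
    (contDiff_infty.1 (contDiff_of_laplacian_ae_eq_zero (hf.contDiff_one hd) hL hΔae) 2)

theorem exists_quadraticForm_of_laplacian_eq_const [Nontrivial E] (hf : IsPosHomogeneous 2 f)
    (hd : ∀ x ≠ 0, ContDiffAt ℝ 2 f x) {c : ℝ} (hΔ : ∀ x ≠ 0, Δ f x = c) :
    ∃ Q : QuadraticForm ℝ E, ∀ x, f x = Q x := by
  let Q₀ : QuadraticForm ℝ E :=
    (c / (2 * finrank ℝ E)) • LinearMap.BilinMap.toQuadraticMap (innerₗ E)
  have hQ₀ : IsPosHomogeneous 2 Q₀ := fun t _ x => by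
    rw [QuadraticMap.map_smul, sq]
  have hΔQ₀ (x : E) : Δ (⇑Q₀) x = c := by
    have hdim : (finrank ℝ E : ℝ) ≠ 0 := by exact_mod_cast finrank_pos.ne'
    rw [laplacian_quadraticForm (stdOrthonormalBasis ℝ E)]
    simp only [Q₀, smul_apply, LinearMap.BilinMap.toQuadraticMap_apply, innerₗ_apply_apply,
      real_inner_self_eq_norm_sq, OrthonormalBasis.norm_eq_one, one_pow, smul_eq_mul, mul_one,
      Finset.sum_const, Finset.card_univ, Fintype.card_fin, nsmul_eq_mul]
    field_simp
  have hC (x : E) : ContDiffAt ℝ 2 Q₀ x := (contDiff_quadraticForm Q₀).contDiffAt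
  obtain ⟨Q, hQ⟩ := (hf.sub hQ₀).exists_quadraticForm_of_laplacian_eq_zero
    (fun x hx => (hd x hx).sub (hC x)) fun x hx => by
      rw [(hd x hx).laplacian_sub (hC x), hΔ x hx, hΔQ₀, sub_self]
  exact ⟨Q + Q₀, fun x => by simp [← hQ]⟩

end IsPosHomogeneous

section RadialExtension

variable {E : Type*} [NormedAddCommGroup E] [InnerProductSpace ℝ E]
  {f : Metric.sphere (0 : E) 1 → ℝ}

theorem radialExtension_coe (f : Metric.sphere (0 : E) 1 → ℝ) (u : Metric.sphere (0 : E) 1) :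
    radialExtension f u = f u := by
  rw [radialExtension, dif_pos (ne_zero_of_mem_unit_sphere u)]
  congr
  simp

theorem isPosHomogeneous_radialExtension (f : Metric.sphere (0 : E) 1 → ℝ) :
    IsPosHomogeneous 0 (radialExtension f) := fun t ht x => by
  rw [pow_zero, one_smul]
  rcases eq_or_ne x 0 with rfl | hx
  · rw [smul_zero]
  · rw [radialExtension, radialExtension, dif_pos hx, dif_pos (smul_ne_zero ht.ne' hx)]
    congr 2
    rw [norm_smul, Real.norm_of_nonneg ht.le, smul_smul, mul_inv, mul_right_comm,
      inv_mul_cancel₀ ht.ne', one_mul]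

theorem contDiffAt_radialExtension {d : ℕ} [Fact (finrank ℝ E = d + 1)] {n : ℕ∞ω}
    (hf : ContMDiff (𝓡 d) 𝓘(ℝ, ℝ) n f) {x : E} (hx : x ≠ 0) :
    ContDiffAt ℝ n (radialExtension f) x := by
  let U : TopologicalSpace.Opens E := ⟨{0}ᶜ, isOpen_compl_singleton⟩
  have hU (y : U) : (y : E) ≠ 0 := y.2
  have hmem (y : U) : ‖(y : E)‖⁻¹ • (y : E) ∈ Metric.sphere (0 : E) 1 := by
    simp [norm_smul, hU y]
  have hproj : ContMDiff 𝓘(ℝ, E) 𝓘(ℝ, E) n fun y : U => ‖(y : E)‖⁻¹ • (y : E) := fun y =>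
    contMDiffAt_subtype_iff (f := fun y : E => ‖y‖⁻¹ • y).2 <| ContDiffAt.contMDiffAt <|
      ((contDiffAt_norm ℝ (hU y)).inv (norm_ne_zero_iff.2 (hU y))).smul contDiffAt_id
  have hcomp := hf.comp (hproj.codRestrict_sphere (n := d) hmem)
  rw [← contMDiffAt_iff_contDiffAt]
  refine (contMDiffAt_subtype_iff (U := U) (x := ⟨x, hx⟩)).1 ?_
  exact (hcomp ⟨x, hx⟩).congr_of_eventuallyEq (.of_forall fun y => dif_pos (hU y))

theorem hasFDerivAt_radialExtension_zero [CompleteSpace E]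
    (hf : ∀ u, HasSphericalGradientAt f 0 u) {x : E} (hx : x ≠ 0) :
    HasFDerivAt (radialExtension f) (0 : E →L[ℝ] ℝ) x := by
  have hx' : 0 < ‖x‖⁻¹ := inv_pos.2 (norm_pos_iff.2 hx)
  have hunit : HasFDerivAt (radialExtension f) (0 : E →L[ℝ] ℝ) (‖x‖⁻¹ • x) := by
    simpa using (hf ⟨‖x‖⁻¹ • x, by simp [norm_smul, hx]⟩).hasFDerivAt
  have hdil := hunit.comp x ((hasFDerivAt_id x).const_smul ‖x‖⁻¹)
  rw [ContinuousLinearMap.zero_comp] at hdil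
  exact hdil.congr_of_eventuallyEq (.of_forall fun y => by
    simpa using (isPosHomogeneous_radialExtension f hx' y).symm)

theorem forall_hasSphericalGradientAt_zero_iff [CompleteSpace E] (hE : 1 < Module.rank ℝ E) :
    (∀ u, HasSphericalGradientAt f 0 u) ↔ ∃ c, ∀ u, f u = c := by
  constructor
  · intro hf
    have : Nontrivial E := rank_pos_iff_nontrivial.1 (zero_lt_one.trans hE)
    obtain ⟨u₀⟩ := (NormedSpace.sphere_nonempty (x := (0 : E)) (r := 1)).2 zero_le_one
    have hd {x : E} (hx : x ≠ 0) := hasFDerivAt_radialExtension_zero hf hx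
    refine ⟨radialExtension f u₀, fun u => ?_⟩
    rw [← radialExtension_coe f u]
    exact isOpen_compl_singleton.is_const_of_fderiv_eq_zero
      (isConnected_compl_singleton_of_one_lt_rank hE 0).isPreconnected
      (fun x hx => (hd hx).differentiableAt.differentiableWithinAt) (fun x hx => (hd hx).fderiv)
      (ne_zero_of_mem_unit_sphere u) (ne_zero_of_mem_unit_sphere ⟨u₀, ‹_›⟩)
  · rintro ⟨c, hc⟩ u
    refine (hasGradientAt_const (u : E) c).congr_of_eventuallyEq ?_
    filter_upwards [isOpen_ne.mem_nhds (ne_zero_of_mem_unit_sphere u)] with x hx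
    rw [radialExtension, dif_pos hx, hc]

/-- The extension of a function on the unit sphere to the whole space that is homogeneous of
degree two. Its ambient Laplacian is the spherical operator of the theorem, applied to the
function. -/
noncomputable def quadraticExtension (f : Metric.sphere (0 : E) 1 → ℝ) (x : E) : ℝ :=
  ‖x‖ ^ 2 * radialExtension f x

theorem isPosHomogeneous_quadraticExtension (f : Metric.sphere (0 : E) 1 → ℝ) :
    IsPosHomogeneous 2 (quadraticExtension f) := fun t ht x => by
  simp [quadraticExtension, isPosHomogeneous_radialExtension f ht, norm_smul, mul_pow, mul_assoc]

theorem quadraticExtension_coe (f : Metric.sphere (0 : E) 1 → ℝ) (u : Metric.sphere (0 : E) 1) :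
    quadraticExtension f u = f u := by
  simp [quadraticExtension, radialExtension_coe]

theorem contDiffAt_quadraticExtension {d : ℕ} [Fact (finrank ℝ E = d + 1)] {n : ℕ∞ω}
    (hf : ContMDiff (𝓡 d) 𝓘(ℝ, ℝ) n f) {x : E} (hx : x ≠ 0) :
    ContDiffAt ℝ n (quadraticExtension f) x :=
  (contDiff_norm_sq ℝ).contDiffAt.mul (contDiffAt_radialExtension hf hx)

theorem quadraticExtension_eq_quadraticForm {Q : QuadraticForm ℝ E} (hQ : ∀ u, f u = Q u) :
    quadraticExtension f = Q := by
  funext x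
  rcases eq_or_ne x 0 with rfl | hx
  · simp [quadraticExtension]
  · let u : Metric.sphere (0 : E) 1 := ⟨‖x‖⁻¹ • x, by simp [norm_smul, hx]⟩
    have hu := quadraticExtension_coe f u
    rw [hQ, QuadraticMap.map_smul] at hu
    rw [(isPosHomogeneous_quadraticExtension f).eq_norm_pow_smul hx, hu]
    simp only [smul_eq_mul]
    field_simp

theorem laplacian_quadraticExtension [FiniteDimensional ℝ E] {u : Metric.sphere (0 : E) 1}
    (hf : ContDiffAt ℝ 2 (radialExtension f) u) :
    Δ (quadraticExtension f) u = sphericalLaplacian f u + 2 * finrank ℝ E * f u := by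
  have heuler : ⟪∇ (fun x : E => ‖x‖ ^ 2) u, ∇ (radialExtension f) u⟫_ℝ = 0 := by
    have hray := (isPosHomogeneous_radialExtension f).fderiv_apply_self
      (hf.differentiableAt two_ne_zero)
    rw [inner_gradient_left, (hasStrictFDerivAt_norm_sq (u : E)).hasFDerivAt.fderiv]
    simp [hray]
  have hmul := laplacian_mul (contDiff_norm_sq ℝ).contDiffAt hf
  rw [heuler, laplacian_norm_sq, radialExtension_coe] at hmul
  refine hmul.trans ?_
  simp [sphericalLaplacian, mul_comm]

theorem forall_laplacian_quadraticExtension_eq_const_iff [FiniteDimensional ℝ E]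
    {d : ℕ} [Fact (finrank ℝ E = d + 1)] (hf : ContMDiff (𝓡 d) 𝓘(ℝ, ℝ) 2 f) :
    (∃ c, ∀ u : Metric.sphere (0 : E) 1, Δ (quadraticExtension f) u = c) ↔
      ∃ Q : QuadraticForm ℝ E, ∀ u : Metric.sphere (0 : E) 1, f u = Q u := by
  have : Nontrivial E := nontrivial_of_finrank_eq_succ (R := ℝ) (n := d) Fact.out
  have hhom := isPosHomogeneous_quadraticExtension f
  constructor
  · rintro ⟨c, hc⟩
    have hΔ (x : E) (hx : x ≠ 0) : Δ (quadraticExtension f) x = c := by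
      rw [hhom.laplacian.eq_norm_pow_smul hx, pow_zero, one_smul]
      exact hc ⟨‖x‖⁻¹ • x, by simp [norm_smul, hx]⟩
    obtain ⟨Q, hQ⟩ := hhom.exists_quadraticForm_of_laplacian_eq_const
      (fun x hx => contDiffAt_quadraticExtension hf hx) hΔ
    exact ⟨Q, fun u => by rw [← hQ, quadraticExtension_coe]⟩
  · rintro ⟨Q, hQ⟩
    refine ⟨2 * ∑ i, Q (stdOrthonormalBasis ℝ E i), fun u => ?_⟩
    rw [quadraticExtension_eq_quadraticForm hQ,
      laplacian_quadraticForm (stdOrthonormalBasis ℝ E)]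

theorem forall_hasSphericalGradientAt_zero_iff_exists_quadraticForm [FiniteDimensional ℝ E]
    {d : ℕ} [Fact (finrank ℝ E = d + 1)] (hE : 1 < Module.rank ℝ E)
    (hf : ContMDiff (𝓡 d) 𝓘(ℝ, ℝ) 2 f) :
    (∀ u, HasSphericalGradientAt (fun v => sphericalLaplacian f v + 2 * finrank ℝ E * f v) 0 u) ↔
      ∃ Q : QuadraticForm ℝ E, ∀ u : Metric.sphere (0 : E) 1, f u = Q u := by
  have hΔ (u : Metric.sphere (0 : E) 1) := laplacian_quadraticExtension
    (contDiffAt_radialExtension hf (ne_zero_of_mem_unit_sphere u))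
  simp only [forall_hasSphericalGradientAt_zero_iff hE, ← hΔ,
    forall_laplacian_quadraticExtension_eq_const_iff hf]

end RadialExtension

section Ellipsoid

theorem supportFunction_image {E F : Type*} [NormedAddCommGroup E] [InnerProductSpace ℝ E]
    [NormedAddCommGroup F] [InnerProductSpace ℝ F] (T : E ≃ₗᵢ[ℝ] F) (S : Set E) (u : F) :
    supportFunction (T '' S) u = supportFunction S (T.symm u) := by
  rw [supportFunction, supportFunction, image_image]
  simp only [LinearIsometryEquiv.inner_map_eq_flip]

variable {ι : Type*} [Fintype ι] {l : ι → ℝ}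

theorem sum_sq_mul_sq_pos (hl : ∀ i, 0 < l i) {w : EuclideanSpace ℝ ι} (hw : w ≠ 0) :
    0 < ∑ i, l i ^ 2 * w i ^ 2 := by
  obtain ⟨j, hj⟩ : ∃ j, w j ≠ 0 := by
    contrapose! hw
    exact PiLp.ext hw
  exact Finset.sum_pos' (fun i _ => by positivity)
    ⟨j, Finset.mem_univ j, mul_pos (pow_pos (hl j) 2) (by positivity)⟩

theorem supportFunction_coordinateEllipsoid (hl : ∀ i, 0 < l i) {w : EuclideanSpace ℝ ι}
    (hw : w ≠ 0) :
    supportFunction {x : EuclideanSpace ℝ ι | ∑ i, x i ^ 2 / l i ^ 2 = 1} w =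
      √(∑ i, l i ^ 2 * w i ^ 2) := by
  have hpos := sum_sq_mul_sq_pos hl hw
  set s := √(∑ i, l i ^ 2 * w i ^ 2)
  have hs : s ≠ 0 := (Real.sqrt_pos.2 hpos).ne'
  have hs2 : ∑ i, l i ^ 2 * w i ^ 2 = s ^ 2 := (Real.sq_sqrt hpos.le).symm
  have hl0 (i : ι) : l i ≠ 0 := (hl i).ne'
  refine IsGreatest.csSup_eq ⟨⟨WithLp.toLp 2 fun i => l i ^ 2 * w i / s, ?_, ?_⟩, ?_⟩
  · calc ∑ i, (l i ^ 2 * w i / s) ^ 2 / l i ^ 2 = ∑ i, l i ^ 2 * w i ^ 2 / s ^ 2 := by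
          refine Finset.sum_congr rfl fun i _ => ?_
          have := hl0 i
          field_simp
      _ = 1 := by rw [← Finset.sum_div, hs2, div_self (pow_ne_zero 2 hs)]
  · calc ⟪WithLp.toLp 2 fun i => l i ^ 2 * w i / s, w⟫_ℝ = ∑ i, l i ^ 2 * w i ^ 2 / s := by
          rw [PiLp.inner_apply]
          refine Finset.sum_congr rfl fun i _ => ?_
          simp only [RCLike.inner_apply, conj_trivial]
          ring
      _ = s := by rw [← Finset.sum_div, hs2, sq, mul_self_div_self]
  · rintro _ ⟨x, hx : ∑ i, x i ^ 2 / l i ^ 2 = 1, rfl⟩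
    refine Real.le_sqrt_of_sq_le ?_
    calc ⟪x, w⟫_ℝ ^ 2 = (∑ i, x i / l i * (l i * w i)) ^ 2 := by
          rw [PiLp.inner_apply]
          congr 1
          refine Finset.sum_congr rfl fun i _ => ?_
          have := hl0 i
          simp only [RCLike.inner_apply, conj_trivial]
          field_simp
      _ ≤ (∑ i, (x i / l i) ^ 2) * ∑ i, (l i * w i) ^ 2 :=
          Finset.sum_mul_sq_le_sq_mul_sq _ _ _
      _ = ∑ i, l i ^ 2 * w i ^ 2 := by simp only [div_pow, mul_pow, hx, one_mul]

theorem exists_orthonormalBasis_quadraticForm_eq_sum {E : Type*} [NormedAddCommGroup E]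
    [InnerProductSpace ℝ E] [FiniteDimensional ℝ E] {m : ℕ} (hm : finrank ℝ E = m)
    (Q : QuadraticForm ℝ E) :
    ∃ b : OrthonormalBasis (Fin m) ℝ E, ∀ x, Q x = ∑ i, Q (b i) * b.repr x i ^ 2 := by
  let B := (QuadraticMap.associated Q).toContinuousBilinearMap
  let A : E →ₗ[ℝ] E := InnerProductSpace.continuousLinearMapOfBilin B
  have hA (x y : E) : ⟪A x, y⟫_ℝ = B x y :=
    InnerProductSpace.continuousLinearMapOfBilin_apply B x y
  have hQ (x : E) : Q x = ⟪A x, x⟫_ℝ := by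
    rw [hA]
    exact (QuadraticMap.associated_eq_self_apply ℝ Q x).symm
  have hsymm : A.IsSymmetric := fun x y => by
    rw [hA, real_inner_comm, hA]
    exact QuadraticMap.associated_isSymm ℝ Q x y
  let b := hsymm.eigenvectorBasis hm
  have hdiag (x : E) : Q x = ∑ i, hsymm.eigenvalues hm i * b.repr x i ^ 2 := by
    rw [hQ, ← b.repr.inner_map_map, PiLp.inner_apply]
    refine Finset.sum_congr rfl fun i _ => ?_
    simp only [b, hsymm.eigenvectorBasis_apply_self_apply hm x i, Real.ringHom_apply,
      RCLike.inner_apply]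
    ring
  have heigenvalue (i : Fin m) : Q (b i) = hsymm.eigenvalues hm i := by
    simp [hdiag, PiLp.single_apply]
  exact ⟨b, fun x => by simp only [heigenvalue, hdiag x]⟩

end Ellipsoid

section EllipsoidSupportFunction

variable {m : ℕ}

theorem IsOriginCenteredEllipsoid.exists_posDef {S : Set (EuclideanSpace ℝ (Fin m))}
    (hS : IsOriginCenteredEllipsoid S) :
    ∃ Q : QuadraticForm ℝ (EuclideanSpace ℝ (Fin m)),
      Q.PosDef ∧ ∀ u ≠ 0, supportFunction S u = √(Q u) := by
  obtain ⟨l, T, hl, rfl⟩ := hS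
  let e : EuclideanSpace ℝ (Fin m) ≃ₗ[ℝ] (Fin m → ℝ) :=
    T.symm.toLinearEquiv.trans (WithLp.linearEquiv 2 ℝ (Fin m → ℝ))
  let Q : QuadraticForm ℝ (EuclideanSpace ℝ (Fin m)) :=
    (QuadraticMap.weightedSumSquares ℝ fun i => l i ^ 2).comp e
  have hQ (u) : Q u = ∑ i, l i ^ 2 * T.symm u i ^ 2 := by
    simp [Q, e, QuadraticMap.weightedSumSquares_apply, sq]
  refine ⟨Q, fun u hu => ?_, fun u hu => ?_⟩
  · rw [hQ]
    exact sum_sq_mul_sq_pos hl (by simpa using hu)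
  · rw [supportFunction_image, supportFunction_coordinateEllipsoid hl (by simpa using hu), hQ]

theorem exists_isOriginCenteredEllipsoid_of_posDef
    {Q : QuadraticForm ℝ (EuclideanSpace ℝ (Fin m))} (hQ : Q.PosDef) :
    ∃ S, IsOriginCenteredEllipsoid S ∧ ∀ u ≠ 0, supportFunction S u = √(Q u) := by
  obtain ⟨b, hb⟩ := exists_orthonormalBasis_quadraticForm_eq_sum finrank_euclideanSpace_fin Q
  have hpos (i : Fin m) : 0 < Q (b i) := hQ _ (b.orthonormal.ne_zero i)
  have haxis (i : Fin m) : 0 < √(Q (b i)) := Real.sqrt_pos.2 (hpos i)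
  refine ⟨_, ⟨fun i => √(Q (b i)), b.repr.symm, haxis, rfl⟩, fun u hu => ?_⟩
  rw [supportFunction_image, supportFunction_coordinateEllipsoid haxis (by simpa using hu), hb u]
  simp only [Real.sq_sqrt (hpos _).le, LinearIsometryEquiv.symm_symm]

theorem exists_isOriginCenteredEllipsoid_supportFunction_eq_iff
    {h : Metric.sphere (0 : EuclideanSpace ℝ (Fin m)) 1 → ℝ} :
    (∃ S : Set (EuclideanSpace ℝ (Fin m)), IsOriginCenteredEllipsoid S ∧
        ∀ u, h u = supportFunction S (u : EuclideanSpace ℝ (Fin m))) ↔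
      (∀ u, 0 < h u) ∧ ∃ Q : QuadraticForm ℝ (EuclideanSpace ℝ (Fin m)),
        ∀ u : Metric.sphere (0 : EuclideanSpace ℝ (Fin m)) 1, h u ^ 2 = Q u := by
  constructor
  · rintro ⟨S, hS, hh⟩
    obtain ⟨Q, hQ, hSQ⟩ := hS.exists_posDef
    have hpos (u : Metric.sphere (0 : EuclideanSpace ℝ (Fin m)) 1) : 0 < Q u :=
      hQ u (ne_zero_of_mem_unit_sphere u)
    have hsqrt (u) : h u = √(Q u) := (hh u).trans (hSQ u (ne_zero_of_mem_unit_sphere u))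
    exact ⟨fun u => hsqrt u ▸ Real.sqrt_pos.2 (hpos u), Q,
      fun u => by rw [hsqrt, Real.sq_sqrt (hpos u).le]⟩
  · rintro ⟨hh, Q, hQ⟩
    have hQpos : Q.PosDef := fun x hx => by
      have hunit : 0 < Q (‖x‖⁻¹ • x) := by
        let u : Metric.sphere (0 : EuclideanSpace ℝ (Fin m)) 1 :=
          ⟨‖x‖⁻¹ • x, by simp [norm_smul, hx]⟩
        exact hQ u ▸ pow_pos (hh u) 2
      rw [QuadraticMap.map_smul] at hunit
      exact pos_of_mul_pos_right hunit (mul_self_nonneg _)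
    obtain ⟨S, hS, hSQ⟩ := exists_isOriginCenteredEllipsoid_of_posDef hQpos
    refine ⟨S, hS, fun u => ?_⟩
    rw [hSQ u (ne_zero_of_mem_unit_sphere u), ← hQ, Real.sqrt_sq (hh u).le]

end EllipsoidSupportFunction

theorem forall_pos_or_forall_neg_of_ne_zero {X : Type*} [TopologicalSpace X] [PreconnectedSpace X]
    {h : X → ℝ} (hc : Continuous h) (hne : ∀ u, h u ≠ 0) : (∀ u, 0 < h u) ∨ ∀ u, h u < 0 := by
  by_contra! H
  obtain ⟨⟨u, hu⟩, v, hv⟩ := H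
  obtain ⟨w, hw⟩ := mem_range_of_exists_le_of_exists_ge hc ⟨u, hu⟩ ⟨v, hv⟩
  exact hne w hw

theorem mainTheorem7 (n d : ℕ) (hn : 3 ≤ n) (hd : d + 2 = n)
    (h : Metric.sphere (0 : EuclideanSpace ℝ (Fin (d + 1))) 1 → ℝ)
    (hC2 : ContMDiff (𝓡 d) 𝓘(ℝ, ℝ) 2 h)
    (hne : ∀ u, h u ≠ 0) :
    (∀ u, HasSphericalGradientAt
        (fun v => sphericalLaplacian (fun w => h w ^ 2) v + 2 * ((n : ℝ) - 1) * h v ^ 2) 0 u) ↔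
      ((∃ S : Set (EuclideanSpace ℝ (Fin (d + 1))), IsOriginCenteredEllipsoid S ∧
          ∀ u, h u = supportFunction S (u : EuclideanSpace ℝ (Fin (d + 1)))) ∨
        (∃ S : Set (EuclideanSpace ℝ (Fin (d + 1))), IsOriginCenteredEllipsoid S ∧
          ∀ u, - h u = supportFunction S (u : EuclideanSpace ℝ (Fin (d + 1))))) := by
  have hdim : finrank ℝ (EuclideanSpace ℝ (Fin (d + 1))) = d + 1 := finrank_euclideanSpace_fin
  have hn' : (n : ℝ) - 1 = finrank ℝ (EuclideanSpace ℝ (Fin (d + 1))) := by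
    rw [hdim, ← hd]
    push_cast
    ring
  have hrank : 1 < Module.rank ℝ (EuclideanSpace ℝ (Fin (d + 1))) := by
    rw [← finrank_eq_rank, hdim]
    exact_mod_cast (by lia : 1 < d + 1)
  have : Fact (finrank ℝ (EuclideanSpace ℝ (Fin (d + 1))) = d + 1) := ⟨hdim⟩
  have : PreconnectedSpace (Metric.sphere (0 : EuclideanSpace ℝ (Fin (d + 1))) 1) :=
    Subtype.preconnectedSpace (isPreconnected_sphere hrank 0 1)
  rw [hn', forall_hasSphericalGradientAt_zero_iff_exists_quadraticForm hrank (hC2.pow 2),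
    exists_isOriginCenteredEllipsoid_supportFunction_eq_iff,
    exists_isOriginCenteredEllipsoid_supportFunction_eq_iff]
  simp only [neg_sq, neg_pos, ← or_and_right]
  exact (and_iff_right (forall_pos_or_forall_neg_of_ne_zero hC2.continuous hne)).symm
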